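/- Let $N=N_n\to\infty$ and $M=M_n$ be sequences of positive integers with $M\mid N$ and $M=o(N)$ (for instance $M$ fixed), and let $p=p_n,\ q=q_n\in[0,1]$. Let $V=\{1,\dots,N\}$ be partitioned into $M$ blocks of size $N/M$, and let $G$ be the random graph on $V$ (loops allowed) in which the pairs $\{v,w\}$, $v,w\in V$ (including $v=w$), are edges independently of each other, with probability $p$ if $v$ and $w$ lie in the same block and with probability $q$ otherwise (the stochastic block model with identical intra-block probabilities). Assume that, as $n\to\infty$, $$\frac{M\log^4 N}{Np+N(M-1)q}\longrightarrow 0,\qquad q\gg\sqrt{\frac{p\log N}{NM}},$$ and that the limit $\kappa=\lim_{n\to\infty}\frac{(M-1)q}{p}\in[0,\infty]$ exists (here $a\gg b$ means $b=o(a)$). For a realization of $G$ let $d_v$ be the degree of $v$ (a loop counts once), consider simple random walk on $G$, which moves from $v$ to each vertex $w$ such that $\{v,w\}$ is an edge with probability $1/d_v$, and let $\pi_v=d_v/\sum_{u\in V}d_u$ be its invariant distribution. Let $H_{vw}$ be the expected first time $t\ge 0$ at which the walk started at $v$ is at $w$, and for each target vertex $w$ put $$H_w=\sum_{v\in V}\pi_v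 H_{vw}.$$ Then $H_w=N(1+o(1))$ asymptotically almost surely, that is, for every $\varepsilon>0$, with probability tending to $1$ as $n\to\infty$, the graph $G$ is connected and, for every $w\in V$, $H_w$ is finite and $$\left|\frac{H_w}{N}-1\right|\le\varepsilon .$$ -/

import Mathlib

open MeasureTheory ProbabilityTheory Filter Asymptotics
open scoped ENNReal Topology

namespace SBM

/-- A realization of a random graph, loops allowed, on the vertex set `Fin N`: the family of edge
indicators `ε_{v,w}`, indexed by the unordered pairs `{v, w}`; the pair `{v, v}` is a loop at `v`. -/
abbrev Config (N : ℕ) : Type := Sym2 (Fin N) → Bool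

/-- The probability that the pair `{v, w}` is an edge: `p` if the two vertices lie in the same block
and `q` otherwise. The block of `v` is `B v`. -/
def edgeProb {N M : ℕ} (B : Fin N → Fin M) (p q : unitInterval) : Sym2 (Fin N) → unitInterval :=
  Sym2.lift ⟨fun v w => if B v = B w then p else q, fun v w => by simp only [eq_comm]⟩

/-- The law of the stochastic block model with diagonal entries `p` and off-diagonal entries `q`:
the edge indicators are independent, each with its own Bernoulli law. -/
noncomputable def sbmMeasure {N M : ℕ} (B : Fin N → Fin M) (p q : unitInterval) :
    Measure (Config N) :=
  Measure.pi fun e => bernoulliMeasure true false (edgeProb B p q e)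

/-- The set of neighbours of `v`; it contains `v` itself if and only if there is a loop at `v`. -/
def nbrs {N : ℕ} (ω : Config N) (v : Fin N) : Finset (Fin N) :=
  Finset.univ.filter fun w => ω s(v, w) = true

/-- The degree `d_v` of `v`; a loop counts once. -/
def deg {N : ℕ} (ω : Config N) (v : Fin N) : ℕ := (nbrs ω v).card

/-- The underlying simple graph (loops removed); it only serves to say that the realization is
connected. -/
def graph {N : ℕ} (ω : Config N) : SimpleGraph (Fin N) where
  Adj v w := v ≠ w ∧ ω s(v, w) = true
  symm := ⟨fun v w h => ⟨h.1.symm, by rw [Sym2.eq_swap]; exact h.2⟩⟩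
  loopless := ⟨fun _ h => h.1 rfl⟩

/-- One step of simple random walk: from `v`, move to a uniformly chosen neighbour of `v`.
(At a vertex of degree `0`, which does not exist in a connected realization with at least two
vertices, the walk stays put.) -/
noncomputable def step {N : ℕ} (ω : Config N) (v : Fin N) : Measure (Fin N) :=
  if nbrs ω v = ∅ then Measure.dirac v else uniformOn (nbrs ω v : Set (Fin N))

/-- The transition kernel of simple random walk. -/
noncomputable def stepKernel {N : ℕ} (ω : Config N) : Kernel (Fin N) (Fin N) :=
  Kernel.ofFunOfCountable (step ω)

instance {N : ℕ} (ω : Config N) : IsMarkovKernel (stepKernel ω) := by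
  refine ⟨fun v => ?_⟩
  change IsProbabilityMeasure (step ω v)
  unfold step
  split_ifs with h
  · infer_instance
  · exact isProbabilityMeasure_uniformOn (Finset.finite_toSet _)
      (by simpa using Finset.nonempty_iff_ne_empty.mpr h)

/-- Given the walk up to time `t`, the position at time `t + 1` is drawn from the transition kernel
at the current position. -/
noncomputable def walkKernel {N : ℕ} (ω : Config N) (t : ℕ) :
    Kernel (Π _ : Finset.Iic t, Fin N) (Fin N) :=
  (stepKernel ω).comap (fun x => x ⟨t, Finset.mem_Iic.mpr le_rfl⟩) (measurable_pi_apply _)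

instance {N : ℕ} (ω : Config N) (t : ℕ) : IsMarkovKernel (walkKernel ω t) := by
  unfold walkKernel; infer_instance

/-- The law, on the space of trajectories, of simple random walk started at `v`. -/
noncomputable def walkLaw {N : ℕ} (ω : Config N) (v : Fin N) : Measure (ℕ → Fin N) :=
  Kernel.traj (X := fun _ => Fin N) (walkKernel ω) 0 (fun _ => v)

/-- The first time `t ≥ 0` at which the trajectory `x` is at `w` (`∞` if it never is). -/
noncomputable def hittingTime {N : ℕ} (w : Fin N) (x : ℕ → Fin N) : ℝ≥0∞ :=
  ⨅ (t : ℕ) (_ : x t = w), (t : ℝ≥0∞)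

/-- `H_{vw}`: the expected time that the walk started at `v` takes to reach `w`. -/
noncomputable def expHit {N : ℕ} (ω : Config N) (v w : Fin N) : ℝ≥0∞ :=
  ∫⁻ x, hittingTime w x ∂(walkLaw ω v)

/-- The invariant distribution `π_v = d_v / ∑_u d_u`. -/
noncomputable def statDist {N : ℕ} (ω : Config N) (v : Fin N) : ℝ≥0∞ :=
  (deg ω v : ℝ≥0∞) / ∑ u, (deg ω u : ℝ≥0∞)

/-- `H_w = ∑_v π_v H_{vw}`. -/
noncomputable def avgHit {N : ℕ} (ω : Config N) (w : Fin N) : ℝ≥0∞ :=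
  ∑ v, statDist ω v * expHit ω v w

end SBM

/-! Fix a realization with adjacency matrix a, degrees d and total degree vol, and let k be the
hitting times of w, H their π-average and g = H - k. Then g has π-mean zero, g(w) = H, and its graph
Laplacian is vol·1_w - d. Reading the Laplacian at w gives d_w H = vol - d_w + ∑_u a_wu g(u). In a
nearly regular graph vol / d_w is close to N, so the neighbour sum is the only real error.

Pairing the Laplacian with g shows that the energy of g is 2·vol·H. Edge expansion gives a
Cheeger-type bound of ∑ d g² by this energy (`Expands.poincare`), and Cauchy–Schwarz turns it into a
bound on the neighbour sum (`Expands.hitting_estimate`). For degrees near μ and expansion constant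
m/2 the outcome is (x - r)² ≤ C (μ/m²) x with x = H/N and r near 1. The bound involves x itself but
only linearly, so it forces x near 1 once μ/m² is small (`connected_and_avgHit`).

All randomness lies in degrees and cuts: Chernoff bounds and a union bound over all vertex sets give
near-regularity and expansion (`measure_not_regular_expands_le`). For M ≥ 2 the edges between
different blocks already give each cut a mean of at least (Nq/4)|S|. The hypotheses yield μ ≥ log⁴ N
and μ log N ≤ 32 m², so μ/m² → 0 and the failure probability is at most 4/N. -/

namespace SBM

/-! ### Edge expansion and the Poincaré inequality. -/

section Cheeger

variable {V : Type*} [Fintype V]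

/-- Twice the Dirichlet energy of `f`. -/
def energy (a : V → V → ℝ) (f : V → ℝ) : ℝ := ∑ u, ∑ v, a u v * (f u - f v) ^ 2

lemma energy_nonneg {a : V → V → ℝ} (ha : ∀ u v, 0 ≤ a u v) (f : V → ℝ) : 0 ≤ energy a f :=
  Finset.sum_nonneg fun u _ => Finset.sum_nonneg fun v _ => mul_nonneg (ha u v) (sq_nonneg _)

variable [DecidableEq V]

/-- The weights `a` expand small sets: the boundary of every set `S` with at most half of the
vertices has weight at least `c * |S|`. -/
def Expands (a : V → V → ℝ) (c : ℝ) : Prop :=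
  ∀ S : Finset V, 2 * S.card ≤ Fintype.card V → c * S.card ≤ ∑ u ∈ S, ∑ v ∈ Sᶜ, a u v

lemma sum_mul_abs_indicator_sub {a : V → V → ℝ} (hsym : ∀ u v, a u v = a v u) (S : Finset V) :
    ∑ u, ∑ v, a u v * |(if u ∈ S then (1 : ℝ) else 0) - (if v ∈ S then 1 else 0)|
      = 2 * ∑ u ∈ S, ∑ v ∈ Sᶜ, a u v := by
  have h1 : ∀ u v, a u v * |(if u ∈ S then (1 : ℝ) else 0) - (if v ∈ S then 1 else 0)|
      = (if u ∈ S then (if v ∈ Sᶜ then a u v else 0) else 0)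
        + (if v ∈ S then (if u ∈ Sᶜ then a v u else 0) else 0) := by
    intro u v
    by_cases hu : u ∈ S <;> by_cases hv : v ∈ S <;> simp [hu, hv, hsym v u]
  have h2 : ∑ u, ∑ v, (if u ∈ S then (if v ∈ Sᶜ then a u v else 0) else 0)
      = ∑ u ∈ S, ∑ v ∈ Sᶜ, a u v := by
    rw [← Finset.sum_subset S.subset_univ fun u _ hu => by simp [hu]]
    refine Finset.sum_congr rfl fun u hu => ?_
    rw [← Finset.sum_subset Sᶜ.subset_univ fun v _ hv => by simp [hv]]
    exact Finset.sum_congr rfl fun v hv => by simp only [hu, hv, if_true]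
  simp only [h1, Finset.sum_add_distrib]
  rw [Finset.sum_comm (f := fun u v => if v ∈ S then (if u ∈ Sᶜ then a v u else 0) else 0), h2]
  ring

/-- An L¹ form of expansion, by the layer-cake decomposition: a nonnegative function is a sum of
multiples of indicators of nested supports, and its total variation is additive along these layers.
The induction peels off one layer at a time. -/
lemma Expands.sum_le {a : V → V → ℝ} {c : ℝ} (hsym : ∀ u v, a u v = a v u)
    (hexp : Expands a c) (n : ℕ) : ∀ f : V → ℝ, (∀ v, 0 ≤ f v) →
    (Finset.univ.filter fun v => f v ≠ 0).card = n → 2 * n ≤ Fintype.card V →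
    2 * c * ∑ v, f v ≤ ∑ u, ∑ v, a u v * |f u - f v| := by
  induction n using Nat.strong_induction_on with
  | _ n ih =>
    intro f hf hn hcard
    set S := Finset.univ.filter fun v => f v ≠ 0 with hS
    have hmem : ∀ v, v ∈ S ↔ f v ≠ 0 := by simp [hS]
    rcases S.eq_empty_or_nonempty with hemp | hne
    · have h0 : ∀ v, f v = 0 := fun v => by
        by_contra h
        exact absurd ((hmem v).2 h) (by simp [hemp])
      simp [h0]
    obtain ⟨x, hx, hmin⟩ := S.exists_min_image f hne
    set m := f x with hm
    have hm0 : 0 < m := lt_of_le_of_ne (hf x) (Ne.symm ((hmem x).1 hx))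
    -- Subtracting the least positive value m from the support S keeps `f'` nonnegative and kills at
    -- least the point `x`. Across the boundary of S the jump drops by exactly m, and inside S
    -- differences are unchanged.
    set f' : V → ℝ := fun v => f v - m * (if v ∈ S then 1 else 0) with hf'
    have hf'0 : ∀ v, 0 ≤ f' v := fun v => by
      by_cases hv : v ∈ S
      · simpa [hf', hv] using hmin v hv
      · simpa [hf', hv] using hf v
    have hnot : ∀ v, v ∉ S → f v = 0 := fun v hv => by
      by_contra h
      exact hv ((hmem v).2 h)
    have hlt : (Finset.univ.filter fun v => f' v ≠ 0).card < n := by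
      rw [← hn]
      apply Finset.card_lt_card
      rw [Finset.ssubset_iff_of_subset]
      · exact ⟨x, hx, by simp [hf', hx, ← hm]⟩
      · intro v hv
        by_contra hvS
        simp [hf', hvS, hnot v hvS] at hv
    have h1 := ih _ hlt f' hf'0 rfl (by omega)
    have h2 := hexp S (by omega)
    have h3 := sum_mul_abs_indicator_sub hsym S
    have h4 : ∑ v, f v = ∑ v, f' v + m * S.card := by
      simp only [hf', Finset.sum_sub_distrib, ← Finset.mul_sum]
      simp
    have h5 : ∑ u, ∑ v, a u v * |f u - f v| = ∑ u, ∑ v, a u v * |f' u - f' v| +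
        m * ∑ u, ∑ v, a u v * |(if u ∈ S then (1 : ℝ) else 0) - (if v ∈ S then 1 else 0)| := by
      rw [Finset.mul_sum, ← Finset.sum_add_distrib]
      refine Finset.sum_congr rfl fun u _ => ?_
      rw [Finset.mul_sum, ← Finset.sum_add_distrib]
      refine Finset.sum_congr rfl fun v _ => ?_
      by_cases hu : u ∈ S <;> by_cases hv : v ∈ S
      · simp [hf', hu, hv]
      · have := hmin u hu
        simp only [hf', hu, hv, hnot v hv, if_true, if_false]
        rw [abs_of_nonneg (by linarith), abs_of_nonneg (by linarith)]
        norm_num; ring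
      · have := hmin v hv
        simp only [hf', hu, hv, hnot u hu, if_true, if_false]
        rw [abs_of_nonpos (by linarith), abs_of_nonpos (by linarith)]
        norm_num; ring
      · simp [hf', hu, hv, hnot u hu, hnot v hv]
    rw [h5, h3, h4]
    nlinarith

/-- Either the set or its complement has at most half of the vertices, and expansion forbids an
empty boundary for whichever is small unless it has no points. -/
lemma Expands.eq_univ {a : V → V → ℝ} {c : ℝ} (hc : 0 < c) (hsym : ∀ u v, a u v = a v u)
    (hexp : Expands a c) {S : Finset V} (hne : S.Nonempty)
    (hS : ∀ u ∈ S, ∀ v ∉ S, a u v = 0) : S = Finset.univ := by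
  have hcard := Finset.card_add_card_compl S
  rcases le_total (2 * S.card) (Fintype.card V) with h | h
  · have h1 := hexp S h
    rw [Finset.sum_eq_zero fun u hu => Finset.sum_eq_zero fun v hv =>
      hS u hu v (Finset.mem_compl.1 hv)] at h1
    have : (0 : ℝ) < S.card := by exact_mod_cast hne.card_pos
    nlinarith
  · have h1 := hexp Sᶜ (by omega)
    rw [compl_compl, Finset.sum_eq_zero fun u hu => Finset.sum_eq_zero fun v hv => by
      rw [hsym]; exact hS v hv u (Finset.mem_compl.1 hu)] at h1
    have h2 : (Sᶜ.card : ℝ) ≤ 0 := by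
      by_contra h0
      push Not at h0
      nlinarith
    have h3 : Sᶜ.card = 0 := by exact_mod_cast le_antisymm h2 (by positivity)
    simpa using h3

/-- Cheeger's argument: apply the L¹ inequality to f² and split |f(u)² - f(v)²| into |f(u) -
f(v)|·|f(u) + f(v)| by Cauchy–Schwarz. The second factor costs at most 4D∑f². -/
lemma Expands.sq_mul_sum_sq_le_of_card_support_le {a : V → V → ℝ} {c D : ℝ} (hc : 0 ≤ c)
    (ha : ∀ u v, 0 ≤ a u v) (hsym : ∀ u v, a u v = a v u) (hexp : Expands a c)
    (hD : ∀ u, ∑ v, a u v ≤ D) (hD0 : 0 ≤ D) {f : V → ℝ}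
    (hcard : 2 * (Finset.univ.filter fun v => f v ≠ 0).card ≤ Fintype.card V) :
    c ^ 2 * ∑ v, f v ^ 2 ≤ D * energy a f := by
  have h1 := hexp.sum_le hsym _ (fun v => f v ^ 2) (fun v => sq_nonneg _) rfl (by simpa using hcard)
  set X := ∑ v, f v ^ 2 with hX
  have hX0 : 0 ≤ X := Finset.sum_nonneg fun v _ => sq_nonneg _
  have hcs : (∑ z : V × V, a z.1 z.2 * |f z.1 ^ 2 - f z.2 ^ 2|) ^ 2 ≤
      (∑ z : V × V, a z.1 z.2 * (f z.1 - f z.2) ^ 2) *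
        ∑ z : V × V, a z.1 z.2 * (f z.1 + f z.2) ^ 2 := by
    refine Finset.sum_sq_le_sum_mul_sum_of_sq_le_mul _
      (fun z _ => mul_nonneg (ha _ _) (sq_nonneg _))
      (fun z _ => mul_nonneg (ha _ _) (sq_nonneg _)) fun z _ => ?_
    rw [mul_pow, sq_abs]; exact le_of_eq (by ring)
  simp only [Fintype.sum_prod_type] at hcs
  have h2 : ∑ u, ∑ v, a u v * (f u + f v) ^ 2 ≤ 4 * D * X := by
    have h3 : ∑ u, ∑ v, a u v * (f u + f v) ^ 2 ≤
        ∑ u, ∑ v, (2 * (a u v * f u ^ 2) + 2 * (a u v * f v ^ 2)) :=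
      Finset.sum_le_sum fun u _ => Finset.sum_le_sum fun v _ => by
        nlinarith [mul_nonneg (ha u v) (sq_nonneg (f u - f v))]
    have h4 : ∑ u, ∑ v, a u v * f u ^ 2 ≤ D * X := by
      rw [hX, Finset.mul_sum]
      refine Finset.sum_le_sum fun u _ => ?_
      rw [← Finset.sum_mul]
      exact mul_le_mul_of_nonneg_right (hD u) (sq_nonneg _)
    have h5 : ∑ u, ∑ v, a u v * f v ^ 2 = ∑ u, ∑ v, a u v * f u ^ 2 := by
      rw [Finset.sum_comm]
      exact Finset.sum_congr rfl fun u _ => Finset.sum_congr rfl fun v _ => by rw [hsym]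
    simp only [Finset.sum_add_distrib, ← Finset.mul_sum] at h3
    linarith
  have hE := energy_nonneg ha f
  rcases hX0.eq_or_lt with h0 | h0
  · rw [← h0, mul_zero]; positivity
  have h6 : (2 * c * X) ^ 2 ≤ energy a f * (4 * D * X) :=
    ((pow_le_pow_left₀ (by positivity) h1 2).trans hcs).trans
      (mul_le_mul_of_nonneg_left h2 hE)
  have h7 : X * (c ^ 2 * X) ≤ X * (D * energy a f) := by nlinarith
  exact le_of_mul_le_mul_left h7 h0

/-- The positive and negative parts each have small support; their squares add up to f² and their
energies add up to at most that of f. -/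
lemma Expands.sq_mul_sum_sq_le {a : V → V → ℝ} {c D : ℝ} (hc : 0 ≤ c)
    (ha : ∀ u v, 0 ≤ a u v) (hsym : ∀ u v, a u v = a v u) (hexp : Expands a c)
    (hD : ∀ u, ∑ v, a u v ≤ D) (hD0 : 0 ≤ D) {f : V → ℝ}
    (hpos : 2 * (Finset.univ.filter fun v => 0 < f v).card ≤ Fintype.card V)
    (hneg : 2 * (Finset.univ.filter fun v => f v < 0).card ≤ Fintype.card V) :
    c ^ 2 * ∑ v, f v ^ 2 ≤ D * energy a f := by
  have h1 := hexp.sq_mul_sum_sq_le_of_card_support_le hc ha hsym hD hD0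
    (f := fun v => max (f v) 0) (by
      convert hpos using 5 with v
      rcases le_total (f v) 0 with h | h
      · simp [h]
      · simp [h, h.lt_iff_ne'])
  have h2 := hexp.sq_mul_sum_sq_le_of_card_support_le hc ha hsym hD hD0
    (f := fun v => max (-f v) 0) (by
      convert hneg using 5 with v
      rcases le_total (f v) 0 with h | h
      · simp [h, h.lt_iff_ne]
      · simp [h])
  have h3 : ∑ v, f v ^ 2 = ∑ v, max (f v) 0 ^ 2 + ∑ v, max (-f v) 0 ^ 2 := by
    rw [← Finset.sum_add_distrib]
    refine Finset.sum_congr rfl fun v _ => ?_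
    rcases le_total (f v) 0 with h | h <;> simp [h]
  have h4 : energy a (fun v => max (f v) 0) + energy a (fun v => max (-f v) 0) ≤ energy a f := by
    simp only [energy, ← Finset.sum_add_distrib, ← mul_add]
    refine Finset.sum_le_sum fun u _ => Finset.sum_le_sum fun v _ =>
      mul_le_mul_of_nonneg_left ?_ (ha u v)
    rcases le_total (f u) 0 with h | h <;> rcases le_total (f v) 0 with h' | h' <;>
      simp only [h, h', max_eq_left, max_eq_right, neg_nonneg, neg_nonpos] <;> nlinarith
  rw [h3, mul_add]
  nlinarith

lemma exists_median [Nonempty V] (f : V → ℝ) :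
    ∃ m, 2 * (Finset.univ.filter fun v => m < f v).card ≤ Fintype.card V ∧
      2 * (Finset.univ.filter fun v => f v < m).card ≤ Fintype.card V := by
  set T := Finset.univ.filter fun x => 2 * (Finset.univ.filter fun v => f x < f v).card ≤
    Fintype.card V with hT
  have hTne : T.Nonempty := by
    obtain ⟨x, -, hx⟩ := Finset.univ.exists_max_image f Finset.univ_nonempty
    refine ⟨x, ?_⟩
    simp only [hT, Finset.mem_filter, Finset.mem_univ, true_and]
    rw [Finset.filter_false_of_mem fun v _ => not_lt.2 (hx v (Finset.mem_univ _))]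
    simp
  -- The median is the least value with at most half of the points above it. The next smaller value,
  -- attained at `y` below, fails that test, so more than half of the points lie above it, and these
  -- are disjoint from the points below the median.
  obtain ⟨x, hxT, hx⟩ := T.exists_min_image f hTne
  refine ⟨f x, by simpa [hT] using hxT, ?_⟩
  rcases (Finset.univ.filter fun v => f v < f x).eq_empty_or_nonempty with h | h
  · simp [h]
  obtain ⟨y, hy, hmax⟩ := Finset.exists_max_image _ f h
  have hyx : f y < f x := by simpa using hy
  have hyT : ¬ 2 * (Finset.univ.filter fun v => f y < f v).card ≤ Fintype.card V := fun hle =>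
    absurd (hx y (by simpa [hT] using hle)) (not_le.2 hyx)
  have hdisj : Disjoint (Finset.univ.filter fun v => f v < f x)
      (Finset.univ.filter fun v => f y < f v) := by
    rw [Finset.disjoint_left]
    intro v hv hv'
    have := hmax v hv
    simp only [Finset.mem_filter, Finset.mem_univ, true_and] at hv'
    linarith
  have := Finset.card_le_univ ((Finset.univ.filter fun v => f v < f x) ∪
    (Finset.univ.filter fun v => f y < f v))
  rw [Finset.card_union_of_disjoint hdisj] at this
  omega

/-- A Cheeger-type Poincaré inequality. -/
lemma Expands.poincare {a : V → V → ℝ} {c D : ℝ} (hc : 0 ≤ c)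
    (ha : ∀ u v, 0 ≤ a u v) (hsym : ∀ u v, a u v = a v u) (hexp : Expands a c)
    (hD : ∀ u, ∑ v, a u v ≤ D) (hD0 : 0 ≤ D) {g : V → ℝ}
    (hg : ∑ u, (∑ v, a u v) * g u = 0) :
    c ^ 2 * ∑ u, (∑ v, a u v) * g u ^ 2 ≤ D ^ 2 * energy a g := by
  rcases isEmpty_or_nonempty V with _ | _
  · simp [energy]
  obtain ⟨m, hm1, hm2⟩ := exists_median g
  have h1 := hexp.sq_mul_sum_sq_le hc ha hsym hD hD0 (f := fun v => g v - m)
    (by simpa using hm1) (by simpa using hm2)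
  have h2 : energy a (fun v => g v - m) = energy a g := by simp [energy]
  -- Expansion needs g centred at a median, while g is centred at its weighted mean. The mean
  -- minimises the weighted square deviation, so moving to the median only increases the left side.
  have h3 : ∑ u, (∑ v, a u v) * g u ^ 2 ≤ D * ∑ u, (g u - m) ^ 2 := by
    calc ∑ u, (∑ v, a u v) * g u ^ 2
        ≤ ∑ u, (∑ v, a u v) * g u ^ 2 + m ^ 2 * ∑ u, ∑ v, a u v :=
          le_add_of_nonneg_right (mul_nonneg (sq_nonneg _)
            (Finset.sum_nonneg fun u _ => Finset.sum_nonneg fun v _ => ha u v))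
      _ = ∑ u, (∑ v, a u v) * (g u - m) ^ 2 := by
          have : ∀ u, (∑ v, a u v) * (g u - m) ^ 2 = (∑ v, a u v) * g u ^ 2
            - 2 * m * ((∑ v, a u v) * g u) + m ^ 2 * ∑ v, a u v := fun u => by ring
          simp only [this, Finset.sum_add_distrib, Finset.sum_sub_distrib, ← Finset.mul_sum, hg]
          ring
      _ ≤ _ := by
          rw [Finset.mul_sum]
          exact Finset.sum_le_sum fun u _ => mul_le_mul_of_nonneg_right (hD u) (sq_nonneg _)
  rw [h2] at h1
  calc c ^ 2 * ∑ u, (∑ v, a u v) * g u ^ 2 ≤ c ^ 2 * (D * ∑ u, (g u - m) ^ 2) :=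
        mul_le_mul_of_nonneg_left h3 (sq_nonneg _)
    _ = D * (c ^ 2 * ∑ u, (g u - m) ^ 2) := by ring
    _ ≤ D * (D * energy a g) := mul_le_mul_of_nonneg_left h1 hD0
    _ = _ := by ring

end Cheeger

/-! ### Hitting times as a potential: existence and the estimate. -/

section Potential

variable {V : Type*} [Fintype V]

lemma energy_eq {a : V → V → ℝ} (hsym : ∀ u v, a u v = a v u) (f : V → ℝ) :
    energy a f = 2 * ∑ u, f u * ((∑ v, a u v) * f u - ∑ v, a u v * f v) := by
  have h : ∀ u v, a u v * (f u - f v) ^ 2 =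
      a u v * f u ^ 2 + a u v * f v ^ 2 - 2 * (f u * (a u v * f v)) := fun u v => by ring
  have h5 : ∑ u, ∑ v, a u v * f v ^ 2 = ∑ u, ∑ v, a u v * f u ^ 2 := by
    rw [Finset.sum_comm]
    exact Finset.sum_congr rfl fun u _ => Finset.sum_congr rfl fun v _ => by rw [hsym]
  simp only [energy, h, Finset.sum_add_distrib, Finset.sum_sub_distrib, h5, ← Finset.mul_sum,
    ← Finset.sum_mul, mul_sub]
  have : ∀ u, f u * ((∑ v, a u v) * f u) = (∑ v, a u v) * f u ^ 2 := fun u => by ring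
  simp only [this]
  ring

variable [DecidableEq V]

/-- The hitting time equations for the target `w` have a nonnegative solution. -/
lemma Expands.exists_hitting {a : V → V → ℝ} {c : ℝ} (hc : 0 < c)
    (ha : ∀ u v, 0 ≤ a u v) (hsym : ∀ u v, a u v = a v u) (hexp : Expands a c)
    (hd : ∀ u, 0 < ∑ v, a u v) (w : V) :
    ∃ k : V → ℝ, (∀ v, 0 ≤ k v) ∧ k w = 0 ∧
      ∀ v, v ≠ w → (∑ u, a v u) * k v = ∑ u, a v u + ∑ u, a v u * k u := by
  -- The Laplacian with a Dirichlet condition at w. In finite dimension solvability follows from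
  -- injectivity: a kernel element has zero energy, so its zero set, which contains w, has empty
  -- boundary and is everything.
  let T : (V → ℝ) →ₗ[ℝ] (V → ℝ) :=
    { toFun := fun f v => if v = w then f w else (∑ u, a v u) * f v - ∑ u, a v u * f u
      map_add' := fun f g => by
        ext v
        by_cases h : v = w
        · simp [h]
        · simp only [h, if_false, Pi.add_apply, mul_add, Finset.sum_add_distrib]; ring
      map_smul' := fun r f => by
        ext v
        by_cases h : v = w
        · simp [h]
        · simp only [h, if_false, Pi.smul_apply, smul_eq_mul, RingHom.id_apply, mul_sub,
            Finset.mul_sum]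
          congr 1
          · rw [Finset.sum_mul, Finset.sum_mul, Finset.mul_sum]
            exact Finset.sum_congr rfl fun u _ => by ring
          · exact Finset.sum_congr rfl fun u _ => by ring }
  have hT : ∀ f v, T f v = if v = w then f w else (∑ u, a v u) * f v - ∑ u, a v u * f u :=
    fun _ _ => rfl
  have hinj : Function.Injective T := by
    rw [injective_iff_map_eq_zero]
    intro f hf
    have hw : f w = 0 := by simpa [hT] using congrFun hf w
    have hE : energy a f = 0 := by
      rw [energy_eq hsym, Finset.sum_eq_zero, mul_zero]
      intro v _
      by_cases h : v = w
      · rw [h, hw, zero_mul]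
      · have := congrFun hf v
        rw [hT, if_neg h] at this
        rw [this]; simp
    have hedge : ∀ u v, a u v * (f u - f v) ^ 2 = 0 := by
      intro u v
      have h1 := (Finset.sum_eq_zero_iff_of_nonneg fun u _ => Finset.sum_nonneg fun v _ =>
        mul_nonneg (ha u v) (sq_nonneg (f u - f v))).1 hE u (Finset.mem_univ _)
      exact (Finset.sum_eq_zero_iff_of_nonneg fun v _ =>
        mul_nonneg (ha u v) (sq_nonneg (f u - f v))).1 h1 v (Finset.mem_univ _)
    have hS := hexp.eq_univ hc hsym (S := Finset.univ.filter fun v => f v = 0)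
      ⟨w, by simpa using hw⟩ fun u hu v hv => by
        simp only [Finset.mem_filter, Finset.mem_univ, true_and] at hu hv
        have := hedge u v
        simpa [hu, hv] using this
    ext v
    have : v ∈ Finset.univ.filter fun v => f v = 0 := by rw [hS]; exact Finset.mem_univ v
    simpa using this
  obtain ⟨k, hk⟩ := LinearMap.injective_iff_surjective.1 hinj
    fun v => if v = w then 0 else ∑ u, a v u
  have hkw : k w = 0 := by simpa [hT] using congrFun hk w
  have hkv : ∀ v, v ≠ w → (∑ u, a v u) * k v = ∑ u, a v u + ∑ u, a v u * k u := by
    intro v hv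
    have := congrFun hk v
    rw [hT, if_neg hv, if_neg hv] at this
    linarith
  refine ⟨k, ?_, hkw, hkv⟩
  -- Minimum principle: at a minimum other than w the equation would force the positive degree to be
  -- at most 0.
  obtain ⟨x, -, hx⟩ := Finset.univ.exists_min_image k ⟨w, Finset.mem_univ w⟩
  have hx0 : 0 ≤ k x := by
    by_cases hxw : x = w
    · rw [hxw, hkw]
    · exfalso
      have h1 := hkv x hxw
      have h2 : (∑ u, a x u) * k x ≤ ∑ u, a x u * k u := by
        rw [Finset.sum_mul]
        exact Finset.sum_le_sum fun u _ =>
          mul_le_mul_of_nonneg_left (hx u (Finset.mem_univ u)) (ha x u)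
      linarith [hd x]
  exact fun v => hx0.trans (hx v (Finset.mem_univ v))

/-- The averaged hitting time `H` of `w` is `vol / d_w - 1`, up to an error that is controlled by
the expansion. -/
lemma Expands.hitting_estimate {a : V → V → ℝ} {c D δ : ℝ} (hc : 0 < c)
    (ha : ∀ u v, 0 ≤ a u v) (ha1 : ∀ u v, a u v ≤ 1) (hsym : ∀ u v, a u v = a v u)
    (hexp : Expands a c) (hD : ∀ u, ∑ v, a u v ≤ D) (hδ : 0 < δ) (hd : ∀ u, δ ≤ ∑ v, a u v)
    {w : V} {k : V → ℝ} (hkw : k w = 0)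
    (hk : ∀ v, v ≠ w → (∑ u, a v u) * k v = ∑ u, a v u + ∑ u, a v u * k u) {H : ℝ}
    (hH : (∑ v, ∑ u, a v u) * H = ∑ v, (∑ u, a v u) * k v) :
    δ * c ^ 2 * ((∑ u, a w u) * H - (∑ v, ∑ u, a v u) + ∑ u, a w u) ^ 2 ≤
      2 * (∑ u, a w u) * D ^ 2 * (∑ v, ∑ u, a v u) * H := by
  set d : V → ℝ := fun v => ∑ u, a v u with hdd
  set vol := ∑ v, d v with hvol
  have hD0 : 0 ≤ D := (hδ.le.trans (hd w)).trans (hD w)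
  set g : V → ℝ := fun v => H - k v with hg
  have hgw : g w = H := by simp [hg, hkw]
  have hL : ∀ v, v ≠ w → d v * g v - ∑ u, a v u * g u = - d v := by
    intro v hv
    have : ∑ u, a v u * g u = d v * H - ∑ u, a v u * k u := by
      simp [hg, mul_sub, hdd, Finset.sum_mul]
    rw [this]
    have := hk v hv
    simp only [hg]
    linarith
  have hg0 : ∑ u, d u * g u = 0 := by
    simp only [hg, mul_sub, Finset.sum_sub_distrib, ← Finset.sum_mul]
    linarith
  -- The Laplacian of any function sums to zero, which determines its value at w from the equations
  -- at the other vertices.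
  have hLsum : ∑ v, (d v * g v - ∑ u, a v u * g u) = 0 := by
    rw [Finset.sum_sub_distrib, Finset.sum_comm, sub_eq_zero]
    refine Finset.sum_congr rfl fun v _ => ?_
    rw [hdd, Finset.sum_mul]
    exact Finset.sum_congr rfl fun u _ => by rw [hsym]
  have hvs : vol = d w + ∑ v ∈ Finset.univ.erase w, d v :=
    (Finset.add_sum_erase _ _ (Finset.mem_univ w)).symm
  have hLw : d w * g w - ∑ u, a w u * g u = vol - d w := by
    have h := Finset.add_sum_erase _ (fun v => d v * g v - ∑ u, a v u * g u) (Finset.mem_univ w)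
    rw [hLsum, Finset.sum_congr rfl fun v hv => hL v (Finset.ne_of_mem_erase hv),
      Finset.sum_neg_distrib] at h
    linarith
  have hL' : ∀ v, d v * g v - ∑ u, a v u * g u = (if v = w then vol else 0) - d v := by
    intro v
    by_cases hv : v = w
    · rw [if_pos hv, hv, hLw]
    · rw [if_neg hv, hL v hv, zero_sub]
  -- Pairing g with vol·1_w - d leaves vol·g(w), because g is orthogonal to d.
  have hE : energy a g = 2 * (vol * H) := by
    rw [energy_eq hsym]
    change 2 * ∑ u, g u * (d u * g u - ∑ v, a u v * g v) = _
    simp only [hL', mul_sub, Finset.sum_sub_distrib, mul_ite, mul_zero, Finset.sum_ite_eq',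
      Finset.mem_univ, if_true, hgw]
    simp only [mul_comm (g _) (d _), hg0]
    ring
  have hP := hexp.poincare hc.le ha hsym hD hD0 hg0
  have h1 : δ * ∑ u, g u ^ 2 ≤ ∑ u, d u * g u ^ 2 := by
    rw [Finset.mul_sum]
    exact Finset.sum_le_sum fun u _ => mul_le_mul_of_nonneg_right (hd u) (sq_nonneg _)
  -- Since 0 ≤ a ≤ 1, a² ≤ a, so the squared weights sum to at most d_w.
  have h2 : (∑ u, a w u * g u) ^ 2 ≤ d w * ∑ u, g u ^ 2 := by
    refine (Finset.sum_mul_sq_le_sq_mul_sq _ _ _).trans ?_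
    refine mul_le_mul_of_nonneg_right (Finset.sum_le_sum fun u _ => ?_)
      (Finset.sum_nonneg fun u _ => sq_nonneg _)
    nlinarith [ha w u, ha1 w u]
  have h3 : d w * H - vol + d w = ∑ u, a w u * g u := by rw [← hgw]; linarith
  change δ * c ^ 2 * (d w * H - vol + d w) ^ 2 ≤ 2 * d w * D ^ 2 * vol * H
  have hdw : 0 ≤ d w := hδ.le.trans (hd w)
  rw [h3]
  calc δ * c ^ 2 * (∑ u, a w u * g u) ^ 2
      ≤ δ * c ^ 2 * (d w * ∑ u, g u ^ 2) := mul_le_mul_of_nonneg_left h2 (by positivity)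
    _ = d w * (c ^ 2 * (δ * ∑ u, g u ^ 2)) := by ring
    _ ≤ d w * (c ^ 2 * ∑ u, d u * g u ^ 2) := by gcongr
    _ ≤ d w * (D ^ 2 * energy a g) := mul_le_mul_of_nonneg_left hP hdw
    _ = _ := by rw [hE]; ring

end Potential

/-! ### Expected hitting times from the trajectory law. -/

section HittingTimes

variable {N : ℕ} {ω : Config N}

lemma lintegral_step {v : Fin N} (h : (nbrs ω v).Nonempty) (ψ : Fin N → ℝ≥0∞) :
    ∫⁻ u, ψ u ∂(step ω v) = (∑ u ∈ nbrs ω v, ψ u) / deg ω v := by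
  rw [step, if_neg h.ne_empty, lintegral_fintype, ENNReal.div_eq_inv_mul, Finset.mul_sum,
    ← Finset.sum_subset (nbrs ω v).subset_univ]
  · refine Finset.sum_congr rfl fun u hu => ?_
    rw [← Finset.coe_singleton, uniformOn_apply_finset, Finset.inter_singleton_of_mem hu,
      Finset.card_singleton, Nat.cast_one, one_div, mul_comm]
    rfl
  · intro u _ hu
    rw [← Finset.coe_singleton, uniformOn_apply_finset, Finset.inter_singleton_of_notMem hu]
    simp

/-- The Markov property at time `t`. -/
lemma lintegral_walkLaw_succ (v : Fin N) (t : ℕ) (F : (Π _ : Finset.Iic t, Fin N) → ℝ≥0∞)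
    (ψ : Fin N → ℝ≥0∞) :
    ∫⁻ x, F (Preorder.frestrictLe t x) * ψ (x (t + 1)) ∂(walkLaw ω v) =
      ∫⁻ x, F (Preorder.frestrictLe t x) * ∫⁻ u, ψ u ∂(step ω (x t)) ∂(walkLaw ω v) := by
  have hmap := Kernel.partialTraj_compProd_eq_map_traj (κ := walkKernel ω) (X := fun _ => Fin N)
    (Nat.zero_le t) (x₀ := fun _ => v)
  have hG : Measurable fun z : (Π _ : Finset.Iic t, Fin N) × Fin N => F z.1 * ψ z.2 :=
    measurable_of_countable _
  have h1 : ∫⁻ x, F (Preorder.frestrictLe t x) * ψ (x (t + 1)) ∂(walkLaw ω v) =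
      ∫⁻ z, F z.1 * ψ z.2 ∂((walkLaw ω v).map fun x => (Preorder.frestrictLe t x, x (t + 1))) := by
    rw [lintegral_map hG (by fun_prop)]
  have h2 : ∫⁻ x, F (Preorder.frestrictLe t x) * ∫⁻ u, ψ u ∂(step ω (x t)) ∂(walkLaw ω v) =
      ∫⁻ y, F y * ∫⁻ u, ψ u ∂(step ω (y ⟨t, Finset.mem_Iic.mpr le_rfl⟩))
        ∂((walkLaw ω v).map (Preorder.frestrictLe t)) := by
    rw [lintegral_map (measurable_of_countable _) (by fun_prop)]
    rfl
  rw [h1, h2, walkLaw, ← hmap, Kernel.traj_map_frestrictLe_apply, Measure.lintegral_compProd hG]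
  refine lintegral_congr fun y => ?_
  exact lintegral_const_mul (F y) (measurable_of_countable ψ)

lemma walkLaw_zero (v : Fin N) (ψ : Fin N → ℝ≥0∞) :
    ∫⁻ x, ψ (x 0) ∂(walkLaw ω v) = ψ v := by
  have h : ∫⁻ x, ψ (x 0) ∂(walkLaw ω v) = ∫⁻ y, ψ (y ⟨0, Finset.mem_Iic.mpr le_rfl⟩)
      ∂((walkLaw ω v).map (Preorder.frestrictLe 0)) := by
    rw [lintegral_map (measurable_of_countable _) (by fun_prop)]
    rfl
  rw [h, walkLaw, Kernel.traj_map_frestrictLe_apply, Kernel.partialTraj_self, Kernel.id_apply,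
    lintegral_dirac]

/-- The indicator that the path `y` has not been at `w` up to time `t`. -/
def avoids (w : Fin N) (t : ℕ) (y : Π _ : Finset.Iic t, Fin N) : ℝ≥0∞ :=
  if ∀ j, y j ≠ w then 1 else 0

lemma avoids_succ_mul (w : Fin N) (t : ℕ) (x : ℕ → Fin N) {ψ : Fin N → ℝ≥0∞} (hψ : ψ w = 0) :
    avoids w (t + 1) (Preorder.frestrictLe (t + 1) x) * ψ (x (t + 1)) =
      avoids w t (Preorder.frestrictLe t x) * ψ (x (t + 1)) := by
  by_cases h : x (t + 1) = w
  · rw [h, hψ, mul_zero, mul_zero]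
  congr 1
  unfold avoids
  congr 1
  simp only [Preorder.frestrictLe_apply, Subtype.forall, Finset.mem_Iic, eq_iff_iff]
  refine ⟨fun H j hj => H j (by omega), fun H j hj => ?_⟩
  rcases Nat.le_succ_iff.1 hj with hj | rfl
  · exact H j hj
  · exact h

/-- The tail formula T = ∑ₜ 1{T > t}, valid also for T = ∞; it turns the expectation into a series
to which the Markov property applies termwise. -/
lemma hittingTime_eq_tsum (w : Fin N) (x : ℕ → Fin N) :
    hittingTime w x = ∑' t, avoids w t (Preorder.frestrictLe t x) := by
  have hav : ∀ t, avoids w t (Preorder.frestrictLe t x) = if ∀ j ≤ t, x j ≠ w then 1 else 0 := by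
    intro t
    unfold avoids
    congr 1
    simp [Preorder.frestrictLe_apply]
  simp only [hav]
  by_cases h : ∃ t, x t = w
  · classical
    have hlt : ∀ t, (∀ j ≤ t, x j ≠ w) ↔ t ∈ Finset.range (Nat.find h) := fun t => by
      rw [Finset.mem_range, Nat.lt_find_iff]
    simp only [hlt]
    rw [tsum_eq_sum (s := Finset.range (Nat.find h)) fun t ht => if_neg ht,
      Finset.sum_congr rfl fun t ht => if_pos ht]
    rw [Finset.sum_const, Finset.card_range, nsmul_one]
    refine le_antisymm (iInf₂_le (Nat.find h) (Nat.find_spec h)) (le_iInf₂ fun t ht => ?_)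
    exact_mod_cast Nat.find_min' h ht
  · push Not at h
    have h1 : hittingTime w x = ∞ := by simp [hittingTime, h]
    simp [h1, h]

lemma expHit_self (w : Fin N) : expHit ω w w = 0 := by
  have h : ∀ x : ℕ → Fin N, hittingTime w x ≤ if x 0 = w then 0 else ∞ := by
    intro x
    split_ifs with h
    · exact (iInf₂_le 0 h).trans (by simp)
    · exact le_top
  refine le_antisymm ((lintegral_mono h).trans ?_) zero_le
  rw [walkLaw_zero w fun u => if u = w then 0 else ∞]
  simp

/-- A finite solution of the hitting time equations gives the expected hitting times. -/
lemma expHit_eq {w : Fin N} {K : Fin N → ℝ≥0∞} (hfin : ∀ v, K v ≠ ∞) (hKw : K w = 0)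
    (hK : ∀ v, v ≠ w → K v = 1 + ∫⁻ u, K u ∂(step ω v)) (v : Fin N) : expHit ω v w = K v := by
  rcases eq_or_ne v w with rfl | hvw
  · rw [expHit_self, hKw]
  -- `A t` is the probability that w is not hit up to time t, and `R t` is the expectation of K at
  -- time t on that event. The equations for K give `R t = A t + R (t + 1)`, which telescopes.
  set A : ℕ → ℝ≥0∞ := fun t => ∫⁻ x, avoids w t (Preorder.frestrictLe t x) ∂(walkLaw ω v) with hA
  set R : ℕ → ℝ≥0∞ := fun t =>
    ∫⁻ x, avoids w t (Preorder.frestrictLe t x) * K (x t) ∂(walkLaw ω v) with hR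
  have hmeas : ∀ t, Measurable fun x : ℕ → Fin N => avoids w t (Preorder.frestrictLe t x) :=
    fun t => (measurable_of_countable (avoids w t)).comp (Preorder.measurable_frestrictLe t)
  have hT : expHit ω v w = ∑' t, A t := by
    rw [expHit, lintegral_congr (hittingTime_eq_tsum w), lintegral_tsum]
    exact fun t => (hmeas t).aemeasurable
  have hstep : ∀ t, R t = A t + R (t + 1) := by
    intro t
    have h1 : R (t + 1) = ∫⁻ x, avoids w t (Preorder.frestrictLe t x) *
        ∫⁻ u, K u ∂(step ω (x t)) ∂(walkLaw ω v) := by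
      rw [← lintegral_walkLaw_succ]
      exact lintegral_congr fun x => avoids_succ_mul w t x hKw
    rw [h1, hA, ← lintegral_add_left (hmeas t)]
    refine lintegral_congr fun x => ?_
    by_cases h : x t = w
    · have h0 : avoids w t (Preorder.frestrictLe t x) = 0 :=
        if_neg fun H => H ⟨t, Finset.mem_Iic.mpr le_rfl⟩ h
      rw [h0]; simp
    · rw [hK _ h, mul_add, mul_one]
  have hR0 : R 0 = K v := by
    rw [← walkLaw_zero (ω := ω) v K]
    refine lintegral_congr fun x => ?_
    by_cases h : x 0 = w
    · rw [h, hKw, mul_zero]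
    · have : avoids w 0 (Preorder.frestrictLe 0 x) = 1 := by
        refine if_pos ?_
        rintro ⟨j, hj⟩
        obtain rfl : j = 0 := by simpa using hj
        exact h
      rw [this, one_mul]
  have hsum : ∀ t, K v = ∑ s ∈ Finset.range t, A s + R t := by
    intro t
    induction t with
    | zero => simp [hR0]
    | succ t ih => rw [Finset.sum_range_succ, add_assoc, ← hstep, ih]
  have hle : ∑' t, A t ≤ K v := by
    rw [ENNReal.tsum_eq_iSup_nat]
    exact iSup_le fun t => (hsum t).symm ▸ le_self_add
  -- Finiteness of K makes ∑ A converge, so A tends to 0. As K is bounded, the remainder R vanishes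
  -- too, which leaves equality.
  have hA0 : Tendsto A atTop (𝓝 0) :=
    ENNReal.tendsto_atTop_zero_of_tsum_ne_top (ne_top_of_le_ne_top (hfin v) hle)
  have hR1 : ∀ t, R t ≤ A t * ∑ u, K u := by
    intro t
    rw [hA, ← lintegral_mul_const _ (hmeas t)]
    exact lintegral_mono fun x =>
      mul_le_mul_right (Finset.single_le_sum (f := K) (fun _ _ => zero_le) (Finset.mem_univ _)) _
  have hR2 : Tendsto R atTop (𝓝 0) := by
    have h0 := ENNReal.Tendsto.mul_const hA0
      (Or.inr (ENNReal.sum_ne_top.2 fun u _ => hfin u) : (0 : ℝ≥0∞) ≠ 0 ∨ ∑ u, K u ≠ ∞)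
    rw [zero_mul] at h0
    exact tendsto_of_tendsto_of_tendsto_of_le_of_le tendsto_const_nhds h0 (fun _ => zero_le) hR1
  have hlim := (ENNReal.tendsto_nat_tsum A).add hR2
  rw [add_zero] at hlim
  rw [hT]
  exact tendsto_nhds_unique hlim (tendsto_const_nhds.congr hsum)

end HittingTimes

/-! ### Deterministic conclusion for nearly regular expanding realizations. -/

section Realization

variable {N : ℕ}

/-- The adjacency matrix of a realization. -/
def adj (ω : Config N) (u v : Fin N) : ℝ := if ω s(u, v) = true then 1 else 0

lemma adj_nonneg (ω : Config N) (u v : Fin N) : 0 ≤ adj ω u v := by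
  unfold adj; split_ifs <;> norm_num

lemma adj_le_one (ω : Config N) (u v : Fin N) : adj ω u v ≤ 1 := by
  unfold adj; split_ifs <;> norm_num

lemma adj_symm (ω : Config N) (u v : Fin N) : adj ω u v = adj ω v u := by
  unfold adj; rw [Sym2.eq_swap]

lemma sum_adj_mul (ω : Config N) (v : Fin N) (f : Fin N → ℝ) :
    ∑ u, adj ω v u * f u = ∑ u ∈ nbrs ω v, f u := by
  simp [adj, nbrs, Finset.sum_filter]

lemma sum_adj (ω : Config N) (v : Fin N) : ∑ u, adj ω v u = deg ω v := by
  simpa [deg] using sum_adj_mul ω v fun _ => 1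

lemma connected_of_expands (hN : 0 < N) {ω : Config N} {c : ℝ} (hc : 0 < c)
    (hexp : Expands (adj ω) c) : (graph ω).Connected := by
  classical
  have : Nonempty (Fin N) := ⟨⟨0, hN⟩⟩
  refine SimpleGraph.Connected.mk fun x y => ?_
  have hS := hexp.eq_univ hc (adj_symm ω) (S := Finset.univ.filter fun v => (graph ω).Reachable x v)
    ⟨x, by simp⟩ fun u hu v hv => by
      simp only [Finset.mem_filter, Finset.mem_univ, true_and] at hu hv
      unfold adj
      refine if_neg fun h => hv (hu.trans (SimpleGraph.Adj.reachable ⟨?_, h⟩))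
      rintro rfl
      exact hv hu
  have : y ∈ Finset.univ.filter fun v => (graph ω).Reachable x v := by
    rw [hS]; exact Finset.mem_univ y
  simpa using this

/-- Passage from the real-valued potential to `avgHit`: the solution of the hitting equations is the
expected hitting time, so the estimate for the potential transfers. -/
lemma exists_avgHit_eq {ω : Config N} {c D δ : ℝ} (hc : 0 < c) (hexp : Expands (adj ω) c)
    (hD : ∀ u, (deg ω u : ℝ) ≤ D) (hδ : 0 < δ) (hd : ∀ u, δ ≤ (deg ω u : ℝ)) (w : Fin N) :
    ∃ H : ℝ, 0 ≤ H ∧ avgHit ω w = ENNReal.ofReal H ∧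
      δ * c ^ 2 * (deg ω w * H - ∑ v, (deg ω v : ℝ) + deg ω w) ^ 2 ≤
        2 * deg ω w * D ^ 2 * (∑ v, (deg ω v : ℝ)) * H := by
  have hdpos : ∀ u, (0 : ℝ) < deg ω u := fun u => hδ.trans_le (hd u)
  obtain ⟨k, hk0, hkw, hk⟩ := hexp.exists_hitting hc (adj_nonneg ω) (adj_symm ω)
    (fun u => by rw [sum_adj]; exact hdpos u) w
  have hvol : (0 : ℝ) < ∑ v, (deg ω v : ℝ) :=
    Finset.sum_pos (fun v _ => hdpos v) ⟨w, Finset.mem_univ w⟩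
  have hhit : ∀ v, expHit ω v w = ENNReal.ofReal (k v) := by
    refine expHit_eq (fun v => ENNReal.ofReal_ne_top) (by rw [hkw, ENNReal.ofReal_zero])
      fun v hv => ?_
    have hne : (nbrs ω v).Nonempty := by
      rw [← Finset.card_pos]
      exact_mod_cast hdpos v
    have h := hk v hv
    rw [sum_adj, sum_adj_mul] at h
    rw [lintegral_step hne, ← ENNReal.ofReal_sum_of_nonneg fun u _ => hk0 u,
      ← ENNReal.ofReal_natCast, ← ENNReal.ofReal_div_of_pos (hdpos v), ← ENNReal.ofReal_one,
      ← ENNReal.ofReal_add zero_le_one (div_nonneg (Finset.sum_nonneg fun u _ => hk0 u)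
        (hdpos v).le)]
    congr 1
    have := hdpos v
    field_simp
    linarith
  set vol := ∑ v, (deg ω v : ℝ) with hvoldef
  refine ⟨∑ v, deg ω v / vol * k v, Finset.sum_nonneg fun v _ =>
    mul_nonneg (div_nonneg (hdpos v).le hvol.le) (hk0 v), ?_, ?_⟩
  · rw [avgHit, ENNReal.ofReal_sum_of_nonneg fun v _ =>
      mul_nonneg (div_nonneg (hdpos v).le hvol.le) (hk0 v)]
    refine Finset.sum_congr rfl fun v _ => ?_
    rw [ENNReal.ofReal_mul (div_nonneg (hdpos v).le hvol.le), hhit,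
      ENNReal.ofReal_div_of_pos hvol, ENNReal.ofReal_natCast, hvoldef,
      ENNReal.ofReal_sum_of_nonneg fun u _ => (hdpos u).le]
    simp only [ENNReal.ofReal_natCast]
    rfl
  · have h := hexp.hitting_estimate hc (adj_nonneg ω) (adj_le_one ω) (adj_symm ω)
      (fun u => by rw [sum_adj]; exact hD u) hδ (fun u => by rw [sum_adj]; exact hd u) hkw hk
      (H := ∑ v, deg ω v / vol * k v) (by
        simp only [sum_adj]
        rw [Finset.mul_sum]
        refine Finset.sum_congr rfl fun v _ => ?_
        rw [← mul_assoc]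
        congr 1
        simp only [← hvoldef]
        field_simp)
    simpa only [sum_adj] using h

/-- Resolves the self-referential estimate: if x were farther than ε from 1, it would be at least
ε/2 from r, and the square would outgrow the linear right side. -/
lemma abs_sub_one_le_of_sq_le {x r θ ε : ℝ} (hx : 0 ≤ x) (hε : 0 < ε) (hε1 : ε ≤ 1)
    (hr : |r - 1| ≤ ε / 2) (hθ : θ ≤ ε ^ 2 / 16) (h : (x - r) ^ 2 ≤ θ * x) : |x - 1| ≤ ε := by
  obtain ⟨hr1, hr2⟩ := abs_le.1 hr
  have h1 : (x - r) ^ 2 ≤ ε ^ 2 / 16 * x := h.trans (mul_le_mul_of_nonneg_right hθ hx)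
  rw [abs_le]
  constructor
  · by_contra! hlt
    nlinarith [sq_nonneg ε, mul_self_le_mul_self (by linarith : 0 ≤ ε / 2)
      (by linarith : ε / 2 ≤ r - x), mul_pos hε hε]
  · by_contra! hlt
    obtain ⟨y, hy⟩ : ∃ y, y = x - 1 := ⟨_, rfl⟩
    obtain rfl : x = 1 + y := by linarith
    have hy : ε < y := by linarith
    have h2 : (y / 2) * (y / 2) ≤ (1 + y - r) * (1 + y - r) :=
      mul_self_le_mul_self (by linarith) (by linarith)
    have h3 : ε ^ 2 ≤ y ^ 2 := by nlinarith
    have h4 : ε ^ 2 ≤ y := by nlinarith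
    have h5 : ε ^ 2 * y ≤ y * y := mul_le_mul_of_nonneg_right h4 (by linarith)
    nlinarith

/-- Nearly regular realizations with good expansion are connected, and all averaged hitting times
are close to `N`. -/
lemma connected_and_avgHit {ω : Config N} {μ m ε : ℝ} (hμ : 0 < μ) (hm : 0 < m)
    (hε : 0 < ε) (hε1 : ε ≤ 1) (hN : 4 ≤ ε * N) (hμm : 1728 * μ ≤ ε ^ 2 * m ^ 2)
    (hdeg : ∀ v, |(deg ω v : ℝ) - μ| ≤ ε / 16 * μ) (hexp : Expands (adj ω) (m / 2)) :
    (graph ω).Connected ∧ ∀ w : Fin N, avgHit ω w ≠ ∞ ∧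
      |(avgHit ω w).toReal / (N : ℝ) - 1| ≤ ε := by
  have hN0 : (0 : ℝ) < N := by
    by_contra h
    nlinarith
  have hlo : ∀ v, (1 - ε / 16) * μ ≤ deg ω v := fun v => by
    have := (abs_le.1 (hdeg v)).1
    linarith
  have hhi : ∀ v, (deg ω v : ℝ) ≤ (1 + ε / 16) * μ := fun v => by
    have := (abs_le.1 (hdeg v)).2
    linarith
  refine ⟨connected_of_expands (by exact_mod_cast hN0) (half_pos hm) hexp, fun w => ?_⟩
  -- With these values of D, δ and c = m/2 the estimate becomes m²(x - r)² ≤ 36μρx, where x = H/N, ρ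
  -- = vol/(d_w N) and r = ρ - 1/N. As ρ ≤ 3, the factor is at most 108μ, and 1728 = 16·108 makes
  -- this at most (ε²/16)m²x.
  obtain ⟨H, hH0, hH, hest⟩ := exists_avgHit_eq (half_pos hm) hexp (D := 3 / 2 * μ) (δ := μ / 2)
    (fun u => (hhi u).trans (by nlinarith)) (half_pos hμ) (fun u => le_trans (by nlinarith) (hlo u))
    w
  rw [hH]
  refine ⟨ENNReal.ofReal_ne_top, ?_⟩
  rw [ENNReal.toReal_ofReal hH0]
  set d : ℝ := (deg ω w : ℝ) with hd
  have hdlo := hlo w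
  have hdhi := hhi w
  rw [← hd] at hdlo hdhi
  have hd0 : 0 < d := lt_of_lt_of_le (by nlinarith) hdlo
  set vol := ∑ v, (deg ω v : ℝ) with hvol
  have hvlo : N * ((1 - ε / 16) * μ) ≤ vol := by
    have := Finset.card_nsmul_le_sum Finset.univ (fun v => (deg ω v : ℝ)) _ fun v _ => hlo v
    simpa using this
  have hvhi : vol ≤ N * ((1 + ε / 16) * μ) := by
    have := Finset.sum_le_card_nsmul Finset.univ (fun v => (deg ω v : ℝ)) _ fun v _ => hhi v
    simpa using this
  set ρ := vol / (d * N) with hρ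
  have hdN : 0 < d * N := mul_pos hd0 hN0
  have hρhi : ρ ≤ 1 + ε / 4 := by
    rw [hρ, div_le_iff₀ hdN]
    refine hvhi.trans ?_
    have : (1 + ε / 16) * μ ≤ (1 + ε / 4) * d := by nlinarith
    nlinarith
  have hρlo : 1 - ε / 4 ≤ ρ := by
    rw [hρ, le_div_iff₀ hdN]
    refine le_trans ?_ hvlo
    have : (1 - ε / 4) * d ≤ (1 - ε / 16) * μ := by nlinarith
    nlinarith
  have hNinv : 1 / (N : ℝ) ≤ ε / 4 := by
    rw [div_le_iff₀ hN0]; linarith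
  have hNinv0 : 0 < 1 / (N : ℝ) := by positivity
  have hx0 : 0 ≤ H / N := div_nonneg hH0 hN0.le
  refine abs_sub_one_le_of_sq_le (r := ρ - 1 / N) (θ := ε ^ 2 / 16) hx0 hε hε1
    (abs_le.2 ⟨by linarith, by linarith⟩) le_rfl ?_
  set x := H / N with hx
  have hHx : H = x * N := by rw [hx]; field_simp
  have hvρ : vol = ρ * (d * N) := by rw [hρ]; field_simp
  have e1 : d * H - vol + d = (d * N) * (x - (ρ - 1 / N)) := by
    rw [hHx, hvρ]; field_simp; ring
  rw [e1, hHx, hvρ] at hest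
  have h1 : (d * N) ^ 2 * (μ * (m ^ 2 * (x - (ρ - 1 / N)) ^ 2)) ≤
      (d * N) ^ 2 * (μ * (36 * μ * ρ * x)) := by linarith
  have h2 := le_of_mul_le_mul_left (le_of_mul_le_mul_left h1 (by positivity)) hμ
  have h3 : m ^ 2 * (x - (ρ - 1 / N)) ^ 2 ≤ m ^ 2 * (ε ^ 2 / 16 * x) := by
    have h4 : μ * x * ρ ≤ μ * x * 3 := mul_le_mul_of_nonneg_left (by linarith) (by positivity)
    have h5 := mul_le_mul_of_nonneg_right hμm hx0
    linarith
  exact le_of_mul_le_mul_left h3 (by positivity)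

end Realization

/-! ### Chernoff bounds for independent Bernoulli variables. -/

section Concentration

variable {ι κ : Type*} [Fintype ι] [DecidableEq ι]

/-- The law of independent Bernoulli variables with success probabilities `r`. -/
noncomputable abbrev bernoulliPi (r : ι → unitInterval) : Measure (ι → Bool) :=
  Measure.pi fun e => bernoulliMeasure true false (r e)

/-- The number of successes among the indices in `E`. -/
def successes (E : Finset ι) (ω : ι → Bool) : ℝ := ∑ e ∈ E, if ω e = true then 1 else 0

lemma mgf_successes (r : ι → unitInterval) (E : Finset ι) (t : ℝ) :
    mgf (successes E) (bernoulliPi r) t = ∏ e ∈ E, (1 + (r e : ℝ) * (Real.exp t - 1)) := by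
  set f : ι → Bool → ℝ := fun e b => if e ∈ E ∧ b = true then Real.exp t else 1 with hf
  have h : ∀ ω : ι → Bool, Real.exp (t * successes E ω) = ∏ e, f e (ω e) := by
    intro ω
    rw [successes, Finset.mul_sum, Real.exp_sum,
      ← Finset.prod_subset E.subset_univ fun e _ he => by simp [hf, he]]
    refine Finset.prod_congr rfl fun e he => ?_
    by_cases hω : ω e = true <;> simp [hf, he, hω]
  rw [mgf, integral_congr_ae (Eventually.of_forall h)]
  refine (integral_fintype_prod_eq_prod f).trans ?_
  rw [← Finset.prod_subset E.subset_univ fun e _ he => by simp [hf, he]]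
  refine Finset.prod_congr rfl fun e he => ?_
  rw [integral_bernoulliMeasure]
  simp only [hf, he, smul_eq_mul]
  norm_num
  ring

/-- Uses exp t - 1 ≤ t + t² for |t| ≤ 1, then 1 + y ≤ exp y in each factor. -/
lemma mgf_successes_le (r : ι → unitInterval) (E : Finset ι) {t : ℝ} (ht : |t| ≤ 1) :
    mgf (successes E) (bernoulliPi r) t ≤ Real.exp ((t + t ^ 2) * ∑ e ∈ E, (r e : ℝ)) := by
  rw [mgf_successes, Finset.mul_sum, Real.exp_sum]
  refine Finset.prod_le_prod (fun e _ => ?_) fun e _ => ?_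
  · nlinarith [(r e).2.1, (r e).2.2, Real.exp_pos t]
  · have h1 := (abs_le.1 (Real.abs_exp_sub_one_sub_id_le ht)).2
    have h2 := Real.add_one_le_exp ((t + t ^ 2) * (r e : ℝ))
    nlinarith [(r e).2.1]

lemma measure_successes_ge_le (r : ι → unitInterval) (E : Finset ι) {η : ℝ} (h0 : 0 ≤ η)
    (h1 : η ≤ 1) :
    (bernoulliPi r).real {ω | (1 + η) * ∑ e ∈ E, (r e : ℝ) ≤ successes E ω} ≤
      Real.exp (-(η ^ 2 / 4 * ∑ e ∈ E, (r e : ℝ))) := by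
  -- The choice t = η/2 minimises -tη + t², with value -η²/4.
  refine (measure_ge_le_exp_mul_mgf _ (t := η / 2) (by positivity) .of_finite).trans ?_
  refine (mul_le_mul_of_nonneg_left (mgf_successes_le r E (by rw [abs_le]; constructor <;> linarith))
    (Real.exp_nonneg _)).trans ?_
  rw [← Real.exp_add]
  exact Real.exp_le_exp.2 (le_of_eq (by ring))

lemma measure_successes_le_le (r : ι → unitInterval) (E : Finset ι) {η : ℝ} (h0 : 0 ≤ η)
    (h1 : η ≤ 1) :
    (bernoulliPi r).real {ω | successes E ω ≤ (1 - η) * ∑ e ∈ E, (r e : ℝ)} ≤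
      Real.exp (-(η ^ 2 / 4 * ∑ e ∈ E, (r e : ℝ))) := by
  refine (measure_le_le_exp_mul_mgf _ (t := -(η / 2)) (by linarith) .of_finite).trans ?_
  refine (mul_le_mul_of_nonneg_left (mgf_successes_le r E (by rw [abs_le]; constructor <;> linarith))
    (Real.exp_nonneg _)).trans ?_
  rw [← Real.exp_add]
  exact Real.exp_le_exp.2 (le_of_eq (by ring))

end Concentration

/-! ### Near-regularity and expansion with high probability. -/

section RandomGraph

variable {N M : ℕ}

instance (B : Fin N → Fin M) (p q : unitInterval) : IsProbabilityMeasure (sbmMeasure B p q) := by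
  unfold sbmMeasure; infer_instance

lemma deg_eq_successes (ω : Config N) (v : Fin N) :
    (deg ω v : ℝ) = successes (Finset.univ.image fun w => s(v, w)) ω := by
  rw [← sum_adj, successes, Finset.sum_image fun w _ w' _ h => Sym2.congr_right.1 h]
  rfl

/-- Each unordered pair crossing the cut arises from one ordered pair only, so the cut is a sum of
independent indicators without repetition. -/
lemma injOn_mk_product_compl (S : Finset (Fin N)) :
    Set.InjOn (fun z : Fin N × Fin N => s(z.1, z.2)) (S ×ˢ Sᶜ : Finset (Fin N × Fin N)) := by
  rintro ⟨u, v⟩ h ⟨u', v'⟩ h' heq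
  simp only [Finset.coe_product, Set.mem_prod, Finset.mem_coe, Finset.mem_compl] at h h'
  rcases Sym2.eq_iff.1 heq with ⟨rfl, rfl⟩ | ⟨rfl, rfl⟩
  · rfl
  · exact absurd h.1 h'.2

/-- The pairs of vertices that are separated by `S`. -/
def boundary (S : Finset (Fin N)) : Finset (Sym2 (Fin N)) :=
  (S ×ˢ Sᶜ).image fun z => s(z.1, z.2)

lemma sum_boundary (S : Finset (Fin N)) (f : Sym2 (Fin N) → ℝ) :
    ∑ e ∈ boundary S, f e = ∑ u ∈ S, ∑ v ∈ Sᶜ, f s(u, v) := by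
  rw [boundary, Finset.sum_image (injOn_mk_product_compl S), Finset.sum_product]

/-- Evaluates the union bound over cuts: the failure probability for S decays like x to the power
|S|. -/
lemma sum_pow_card_nonempty {x : ℝ} :
    ∑ S : Finset (Fin N), (if S = ∅ then 0 else x ^ S.card) = (1 + x) ^ N - 1 := by
  have h := Fintype.sum_pow_mul_eq_add_pow (Fin N) x 1
  simp only [one_pow, mul_one, Fintype.card_fin] at h
  rw [add_comm 1 x, ← h, ← Finset.add_sum_erase _ _ (Finset.mem_univ (∅ : Finset (Fin N))),
    ← Finset.add_sum_erase _ (fun S : Finset (Fin N) => x ^ S.card) (Finset.mem_univ ∅)]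
  simp only [if_true, Finset.card_empty, pow_zero, zero_add, add_sub_cancel_left]
  exact Finset.sum_congr rfl fun S hS => if_neg (Finset.ne_of_mem_erase hS)

/-- With high probability the stochastic block model is nearly regular and expands. -/
lemma measure_not_regular_expands_le (B : Fin N → Fin M) (p q : unitInterval) {μ m η : ℝ}
    (hη0 : 0 ≤ η) (hη1 : η ≤ 1)
    (hμ : ∀ v, ∑ w, (edgeProb B p q s(v, w) : ℝ) = μ)
    (hm : ∀ S : Finset (Fin N), 2 * S.card ≤ N →
      m * S.card ≤ ∑ u ∈ S, ∑ v ∈ Sᶜ, (edgeProb B p q s(u, v) : ℝ)) :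
    (sbmMeasure B p q).real
      {ω | ¬ ((∀ v, |(deg ω v : ℝ) - μ| ≤ η * μ) ∧ Expands (adj ω) (m / 2))} ≤
      2 * N * Real.exp (-(η ^ 2 / 4 * μ)) + (Real.exp (N * Real.exp (-(m / 16))) - 1) := by
  set P := sbmMeasure B p q with hP
  set r := edgeProb B p q with hr
  have hμ' : ∀ v, ∑ e ∈ Finset.univ.image fun w => s(v, w), (r e : ℝ) = μ := fun v => by
    rw [Finset.sum_image fun w _ w' _ h => Sym2.congr_right.1 h, hμ]
  have hsub : {ω | ¬ ((∀ v, |(deg ω v : ℝ) - μ| ≤ η * μ) ∧ Expands (adj ω) (m / 2))} ⊆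
      ((⋃ v, {ω : Config N | (1 + η) * μ ≤ deg ω v}) ∪
        (⋃ v, {ω : Config N | (deg ω v : ℝ) ≤ (1 - η) * μ})) ∪
      ⋃ S : Finset (Fin N), {ω | 2 * S.card ≤ N ∧
        ∑ u ∈ S, ∑ v ∈ Sᶜ, adj ω u v < m / 2 * S.card} := by
    intro ω hω
    by_contra hnot
    simp only [Set.mem_union, Set.mem_iUnion, Set.mem_ofPred_eq, not_or, not_exists, not_le,
      not_and, not_lt] at hnot
    refine hω ⟨fun v => abs_le.2 ⟨?_, ?_⟩, fun S hS => hnot.2 S (by simpa using hS)⟩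
    · have := hnot.1.2 v; linarith
    · have := hnot.1.1 v; linarith
  have hup : ∀ v, P.real {ω : Config N | (1 + η) * μ ≤ deg ω v} ≤
      Real.exp (-(η ^ 2 / 4 * μ)) := fun v => by
    have := measure_successes_ge_le r (Finset.univ.image fun w => s(v, w)) hη0 hη1
    rw [hμ' v] at this
    simp only [deg_eq_successes]
    exact this
  have hlow : ∀ v, P.real {ω : Config N | (deg ω v : ℝ) ≤ (1 - η) * μ} ≤
      Real.exp (-(η ^ 2 / 4 * μ)) := fun v => by
    have := measure_successes_le_le r (Finset.univ.image fun w => s(v, w)) hη0 hη1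
    rw [hμ' v] at this
    simp only [deg_eq_successes]
    exact this
  have hcut : ∀ S : Finset (Fin N), P.real {ω | 2 * S.card ≤ N ∧
      ∑ u ∈ S, ∑ v ∈ Sᶜ, adj ω u v < m / 2 * S.card} ≤
      if S = ∅ then 0 else Real.exp (-(m / 16)) ^ S.card := by
    intro S
    by_cases hS : S = ∅
    · simp [hS]
    rw [if_neg hS]
    by_cases hcard : 2 * S.card ≤ N
    · have h1 := measure_successes_le_le r (boundary S) (η := 1 / 2) (by norm_num) (by norm_num)
      rw [sum_boundary] at h1
      have h2 := hm S hcard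
      refine (measureReal_mono ?_).trans (h1.trans ?_)
      · rintro ω ⟨-, hω⟩
        have h3 : successes (boundary S) ω = ∑ u ∈ S, ∑ v ∈ Sᶜ, adj ω u v := sum_boundary S _
        rw [Set.mem_ofPred_eq, h3]
        linarith
      · rw [← Real.exp_nat_mul]
        exact Real.exp_le_exp.2 (by linarith)
    · simp only [hcard, false_and, Set.ofPred_false, measureReal_empty]
      positivity
  refine (measureReal_mono hsub).trans ((measureReal_union_le _ _).trans (add_le_add
    ((measureReal_union_le _ _).trans ?_) ?_))
  · have h1 := (measureReal_iUnion_fintype_le (μ := P)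
      fun v => {ω : Config N | (1 + η) * μ ≤ deg ω v}).trans
      (Finset.sum_le_sum fun v _ => hup v)
    have h2 := (measureReal_iUnion_fintype_le (μ := P)
      fun v => {ω : Config N | (deg ω v : ℝ) ≤ (1 - η) * μ}).trans
      (Finset.sum_le_sum fun v _ => hlow v)
    rw [Finset.sum_const, Finset.card_univ, Fintype.card_fin, nsmul_eq_mul] at h1 h2
    linarith
  · refine (measureReal_iUnion_fintype_le _).trans ((Finset.sum_le_sum fun S _ => hcut S).trans ?_)
    rw [sum_pow_card_nonempty, Real.exp_nat_mul]
    refine sub_le_sub_right (pow_le_pow_left₀ (by positivity) ?_ N) 1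
    linarith [Real.add_one_le_exp (Real.exp (-(m / 16)))]

end RandomGraph

/-! ### Expected degrees and expected cuts. -/

section Means

variable {N M : ℕ} {B : Fin N → Fin M}

lemma sum_edgeProb (hB : ∀ m, M * (Finset.univ.filter fun v => B v = m).card = N)
    (p q : unitInterval) (v : Fin N) :
    ∑ w, (edgeProb B p q s(v, w) : ℝ) = ((N : ℝ) * p + N * ((M : ℝ) - 1) * q) / M := by
  have hM : (0 : ℝ) < M := by exact_mod_cast Fin.pos (B v)
  have h1 : ∀ w, (edgeProb B p q s(v, w) : ℝ) =
      q + (if B w = B v then ((p : ℝ) - q) else 0) := by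
    intro w
    change ((if B v = B w then p else q : unitInterval) : ℝ) = _
    by_cases h : B v = B w
    · rw [if_pos h, if_pos h.symm]; ring
    · rw [if_neg h, if_neg (Ne.symm h)]; ring
  have h2 : (M : ℝ) * (Finset.univ.filter fun w => B w = B v).card = N := by
    exact_mod_cast hB (B v)
  simp only [h1, Finset.sum_add_distrib, ← Finset.sum_filter, Finset.sum_const, Finset.card_univ,
    Fintype.card_fin, nsmul_eq_mul]
  rw [eq_div_iff hM.ne']
  linear_combination ((p : ℝ) - q) * h2

/-- A set with at most half of the vertices has many pairs of vertices in different blocks on its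
boundary. -/
lemma card_mul_le_sum_ne (hM : 2 ≤ M)
    (hB : ∀ m, M * (Finset.univ.filter fun v => B v = m).card = N) {S : Finset (Fin N)}
    (hS : 2 * S.card ≤ N) :
    (N : ℝ) / 4 * S.card ≤ ∑ u ∈ S, ∑ v ∈ Sᶜ, if B u = B v then (0 : ℝ) else 1 := by
  have hM' : (2 : ℝ) ≤ M := by exact_mod_cast hM
  have hS' : 2 * (S.card : ℝ) ≤ N := by exact_mod_cast hS
  set a : Fin M → ℝ := fun m => (S.filter fun v => B v = m).card with ha
  have hfib : ∀ m, (M : ℝ) * (a m + (Sᶜ.filter fun v => B v = m).card) = N := by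
    intro m
    refine Eq.trans ?_ (congrArg (Nat.cast : ℕ → ℝ) (hB m))
    rw [ha]
    push_cast
    congr 1
    rw [← Nat.cast_add, ← Finset.card_union_of_disjoint
      (Finset.disjoint_filter_filter disjoint_compl_right), ← Finset.filter_union,
      Finset.union_compl]
  have hinner : ∀ u, ∑ v ∈ Sᶜ, (if B u = B v then (0 : ℝ) else 1) =
      (N - S.card) - (N / M - a (B u)) := by
    intro u
    have h1 : ∀ v, (if B u = B v then (0 : ℝ) else 1) = 1 - if B v = B u then 1 else 0 := by
      intro v
      by_cases h : B u = B v
      · simp [h]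
      · simp [h, Ne.symm h]
    simp only [h1, Finset.sum_sub_distrib, Finset.sum_const, nsmul_eq_mul, mul_one,
      Finset.sum_boole]
    have h2 : (Sᶜ.card : ℝ) = N - S.card := by
      rw [Finset.card_compl, Fintype.card_fin, Nat.cast_sub (by omega)]
    have h3 := hfib (B u)
    rw [h2]
    congr 1
    rw [← h3]
    field_simp
    ring
  have hsq : ∑ u ∈ S, a (B u) = ∑ m, a m ^ 2 := by
    rw [← Finset.sum_fiberwise S B]
    refine Finset.sum_congr rfl fun m _ => ?_
    rw [Finset.sum_congr rfl fun u hu => by rw [(Finset.mem_filter.1 hu).2], Finset.sum_const,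
      nsmul_eq_mul, sq]
  have hsum : ∑ m, a m = S.card := by
    have := Finset.card_eq_sum_card_fiberwise (s := S) (f := B) (t := Finset.univ)
      fun _ _ => Finset.mem_coe.2 (Finset.mem_univ _)
    rw [this, ha]; push_cast; rfl
  -- With a the numbers of points of S in the blocks, the cut equals s(N - s) - sN/M + ∑ a². The
  -- least favourable S is spread evenly over the blocks, which gives s(N - s)(1 - 1/M) ≥
  -- s·(N/2)·(1/2).
  have hcs : (S.card : ℝ) ^ 2 ≤ M * ∑ m, a m ^ 2 := by
    have := sq_sum_le_card_mul_sum_sq (s := (Finset.univ : Finset (Fin M))) (f := a)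
    rwa [hsum, Finset.card_univ, Fintype.card_fin] at this
  simp only [hinner, Finset.sum_sub_distrib, Finset.sum_const, nsmul_eq_mul, hsq]
  set s : ℝ := (S.card : ℝ) with hs
  have hs0 : 0 ≤ s := by positivity
  have hcs' : s ^ 2 / M ≤ ∑ m, a m ^ 2 := by
    rw [div_le_iff₀ (by linarith)]; linarith
  have hMinv : (1 : ℝ) / M ≤ 1 / 2 := one_div_le_one_div_of_le (by norm_num) hM'
  have h4 : s * (N - s) * (1 / 2) ≤ s * (N - s) * (1 - 1 / M) :=
    mul_le_mul_of_nonneg_left (by linarith) (mul_nonneg hs0 (by linarith))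
  have h5 : s * (N - s) * (1 - 1 / M) = s * (N - s) - (s * (N / M) - s ^ 2 / M) := by
    field_simp
  nlinarith

/-- The expected number of edges that leave a set of at most half of the vertices. -/
lemma mul_card_le_sum_edgeProb (hB : ∀ m, M * (Finset.univ.filter fun v => B v = m).card = N)
    (p q : unitInterval) {S : Finset (Fin N)} (hS : 2 * S.card ≤ N) :
    (if M = 1 then (N : ℝ) * p / 2 else N * q / 4) * S.card ≤
      ∑ u ∈ S, ∑ v ∈ Sᶜ, (edgeProb B p q s(u, v) : ℝ) := by
  rcases S.eq_empty_or_nonempty with rfl | ⟨v₀, -⟩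
  · simp
  have hM0 : 0 < M := Fin.pos (B v₀)
  -- A single block has no pairs between different blocks, so its cuts are counted with p; otherwise
  -- only the pairs between blocks are counted.
  split_ifs with hM
  · have h1 : ∀ u v, edgeProb B p q s(u, v) = p := fun u v => if_pos (Fin.ext (by omega))
    have h2 : (Sᶜ.card : ℝ) = N - S.card := by
      rw [Finset.card_compl, Fintype.card_fin, Nat.cast_sub (by omega)]
    simp only [h1, Finset.sum_const, nsmul_eq_mul, h2]
    have hS' : 2 * (S.card : ℝ) ≤ N := by exact_mod_cast hS
    have h3 : 0 ≤ (S.card : ℝ) * p := mul_nonneg (by positivity) p.2.1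
    nlinarith
  · have h1 := mul_le_mul_of_nonneg_right (card_mul_le_sum_ne (by omega) hB hS) q.2.1
    rw [Finset.sum_mul] at h1
    refine le_trans (by linarith) (h1.trans (Finset.sum_le_sum fun u _ => ?_))
    rw [Finset.sum_mul]
    refine Finset.sum_le_sum fun v _ => ?_
    change _ ≤ ((if B u = B v then p else q : unitInterval) : ℝ)
    split_ifs
    · rw [zero_mul]; exact p.2.1
    · rw [one_mul]

end Means

/-! ### Consequences of the growth hypotheses. -/

section Asymptotics

/-- The expected degree `μ` is at most of order `m ^ 2 / log N`, where `m` is the expected number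
of boundary edges per vertex of a small set. -/
lemma expectedDegree_mul_log_le {N M p q L μ : ℝ} (hM : 1 ≤ M) (hN : 0 < N)
    (hq : 0 ≤ q) (hL : 2 ≤ L) (hμ : μ = (N * p + N * (M - 1) * q) / M) (h1 : L ^ 4 ≤ μ)
    (h2 : Real.sqrt (p * L / (N * M)) ≤ q) :
    μ * L ≤ 2 * (N * q) ^ 2 := by
  have hpq : p * L / (N * M) ≤ q ^ 2 := by
    rw [← Real.sqrt_le_left hq]; exact h2
  have hpq' : N * p / M * L ≤ (N * q) ^ 2 := by
    have := mul_le_mul_of_nonneg_left hpq (sq_nonneg N)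
    calc N * p / M * L = N ^ 2 * (p * L / (N * M)) := by field_simp
      _ ≤ _ := by rw [mul_pow]; exact this
  set y := N * q with hy
  have hy0 : 0 ≤ y := mul_nonneg hN.le hq
  have hμy : μ ≤ N * p / M + y := by
    have : (M - 1) / M ≤ 1 := by rw [div_le_one (by linarith)]; linarith
    have h3 := mul_le_mul_of_nonneg_right this hy0
    calc μ = N * p / M + (M - 1) / M * y := by rw [hμ, hy]; field_simp
      _ ≤ _ := by linarith
  have hμL : μ * L ≤ y ^ 2 + y * L := by nlinarith
  -- Otherwise L⁵ ≤ μL ≤ y² + yL < 2L², impossible for L ≥ 2. This absorbs the term yL into y².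
  have hyL : L ≤ y := by
    by_contra! hlt
    have h3 : L ^ 4 * L ≤ μ * L := mul_le_mul_of_nonneg_right h1 (by linarith)
    have h4 : y ^ 2 + y * L ≤ 2 * L ^ 2 := by nlinarith
    have h5 : 8 ≤ L ^ 3 := by
      calc (8 : ℝ) = 2 ^ 3 := by norm_num
        _ ≤ L ^ 3 := pow_le_pow_left₀ (by norm_num) hL 3
    have h6 : L ^ 2 * 8 ≤ L ^ 2 * L ^ 3 := mul_le_mul_of_nonneg_left h5 (sq_nonneg L)
    nlinarith
  nlinarith

/-- The failure probability is at most `4 / N` once the expected degree and the expansion are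
large enough. -/
lemma failure_bound_le {N L μ m ε : ℝ} (hN : 1 ≤ N) (hL : L = Real.log N) (hε : 0 < ε)
    (hε1 : ε ≤ 1) (hLε : 55296 ≤ ε ^ 2 * L) (hm0 : 0 ≤ m) (h1 : L ^ 4 ≤ μ)
    (h2 : μ * L ≤ 32 * m ^ 2) :
    2 * N * Real.exp (-((ε / 16) ^ 2 / 4 * μ)) + (Real.exp (N * Real.exp (-(m / 16))) - 1) ≤
      4 / N := by
  have hN0 : 0 < N := by linarith
  have hεε : ε ^ 2 ≤ 1 := by nlinarith
  have hL' : 0 ≤ L := hL ▸ Real.log_nonneg hN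
  have hL0 : 55296 ≤ L := by nlinarith
  -- Both exponents will be at least 2L, so that multiplying by N still leaves 1/N.
  have hexp2 : N * Real.exp (-(2 * L)) = 1 / N := by
    rw [hL, Real.exp_neg, two_mul, Real.exp_add, Real.exp_log hN0]
    field_simp
  have hL2 : 1 ≤ L ^ 2 := by nlinarith
  have hA : 2 * L ≤ (ε / 16) ^ 2 / 4 * μ := by
    have h3 : ε ^ 2 * L ^ 4 ≤ ε ^ 2 * μ := mul_le_mul_of_nonneg_left h1 (sq_nonneg ε)
    have h4 : 55296 * L ^ 3 ≤ ε ^ 2 * L * L ^ 3 := mul_le_mul_of_nonneg_right hLε (by positivity)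
    have h5 : L * 1 ≤ L * L ^ 2 := mul_le_mul_of_nonneg_left hL2 (by linarith)
    nlinarith
  -- If m < 32L, then L⁵ ≤ μL ≤ 32m² ≤ 32768L², contradicting L ≥ 55296.
  have hB : 2 * L ≤ m / 16 := by
    by_contra! hlt
    have h3 : L ^ 4 * L ≤ μ * L := mul_le_mul_of_nonneg_right h1 (by linarith)
    have h4 : m ^ 2 ≤ (32 * L) ^ 2 := pow_le_pow_left₀ hm0 (by linarith) 2
    have h5 : 55296 * (L * L ^ 2) ≤ L * (L * L ^ 2) :=
      mul_le_mul_of_nonneg_right hL0 (by positivity)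
    have h6 : L ^ 2 * 55296 ≤ L ^ 2 * L := mul_le_mul_of_nonneg_left hL0 (by positivity)
    nlinarith
  have hA' : N * Real.exp (-((ε / 16) ^ 2 / 4 * μ)) ≤ 1 / N := by
    rw [← hexp2]
    exact mul_le_mul_of_nonneg_left (Real.exp_le_exp.2 (by linarith)) hN0.le
  have hB' : N * Real.exp (-(m / 16)) ≤ 1 / N := by
    rw [← hexp2]
    exact mul_le_mul_of_nonneg_left (Real.exp_le_exp.2 (by linarith)) hN0.le
  have hN1 : 1 / N ≤ 1 := by rw [div_le_one hN0]; exact hN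
  have hN2 : 0 ≤ 1 / N := by positivity
  have h3 := Real.exp_le_exp.2 hB'
  have h4 := (abs_le.1 (Real.abs_exp_sub_one_le (x := 1 / N) (by rw [abs_of_nonneg hN2]; exact hN1))).2
  rw [abs_of_nonneg hN2] at h4
  have h5 : 4 / N = 4 * (1 / N) := by ring
  linarith

end Asymptotics

end SBM

/-! ### Assembly of the asymptotic statement. -/

theorem theorem7p2
    (N M : ℕ → ℕ) (B : ∀ n, Fin (N n) → Fin (M n)) (p q : ℕ → unitInterval)
    (hN : Tendsto N atTop atTop)
    (hMN : (fun n => (M n : ℝ)) =o[atTop] fun n => (N n : ℝ))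
    (hB : ∀ n m, M n * (Finset.univ.filter fun v => B n v = m).card = N n)
    (hconn : (fun n => (M n : ℝ) * Real.log (N n) ^ 4) =o[atTop]
      fun n => (N n : ℝ) * (p n : ℝ) + (N n : ℝ) * ((M n : ℝ) - 1) * (q n : ℝ))
    (hq : (fun n => Real.sqrt ((p n : ℝ) * Real.log (N n) / ((N n : ℝ) * (M n : ℝ)))) =o[atTop]
      fun n => (q n : ℝ))
    (κ : ℝ≥0∞)
    (hκ : Tendsto (fun n => ENNReal.ofReal (((M n : ℝ) - 1) * (q n : ℝ)) /
      ENNReal.ofReal (p n : ℝ)) atTop (𝓝 κ))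
    (ε : ℝ) (hε : 0 < ε) :
    Tendsto (fun n => SBM.sbmMeasure (B n) (p n) (q n)
      {ω | (SBM.graph ω).Connected ∧ ∀ w : Fin (N n), SBM.avgHit ω w ≠ ∞ ∧
        |(SBM.avgHit ω w).toReal / (N n : ℝ) - 1| ≤ ε}) atTop (𝓝 1) := by
  set ε' := min ε 1 with hε'
  have hε0 : 0 < ε' := lt_min hε one_pos
  have hε1 : ε' ≤ 1 := min_le_right _ _
  have hNR : Tendsto (fun n => (N n : ℝ)) atTop atTop := tendsto_natCast_atTop_atTop.comp hN
  have hlog : Tendsto (fun n => Real.log (N n)) atTop atTop := Real.tendsto_log_atTop.comp hNR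
  set A : ∀ n, Set (SBM.Config (N n)) := fun n =>
    {ω | (SBM.graph ω).Connected ∧ ∀ w : Fin (N n), SBM.avgHit ω w ≠ ∞ ∧
      |(SBM.avgHit ω w).toReal / (N n : ℝ) - 1| ≤ ε} with hA
  have hbound : ∀ᶠ n in atTop,
      1 - 4 / (N n : ℝ) ≤ (SBM.sbmMeasure (B n) (p n) (q n)).real (A n) := by
    -- The threshold 55296 = 32·1728 turns μL ≤ 32m² into 1728μ ≤ ε'²m².
    filter_upwards [hNR.eventually_ge_atTop 1, hNR.eventually_ge_atTop (4 / ε'),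
      hlog.eventually_ge_atTop (55296 / ε' ^ 2), hconn.bound one_pos, hq.bound one_pos]
      with n hn1 hn4 hL hc hs
    set L := Real.log (N n) with hLdef
    have hLε : 55296 ≤ ε' ^ 2 * L := by
      rw [div_le_iff₀ (by positivity)] at hL; linarith
    have hL0 : 55296 ≤ L := by
      have : ε' ^ 2 ≤ 1 := by nlinarith
      have : 0 ≤ L := Real.log_nonneg hn1
      nlinarith
    have hNpos : 0 < N n := by exact_mod_cast (zero_lt_one.trans_le hn1)
    have hM1 : 1 ≤ M n := Fin.pos (B n ⟨0, hNpos⟩)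
    have hM1' : (1 : ℝ) ≤ M n := by exact_mod_cast hM1
    have hp0 : (0 : ℝ) ≤ p n := (p n).2.1
    have hq0 : (0 : ℝ) ≤ q n := (q n).2.1
    set μ := ((N n : ℝ) * p n + N n * ((M n : ℝ) - 1) * q n) / M n with hμ
    have hμL : L ^ 4 ≤ μ := by
      rw [one_mul, Real.norm_of_nonneg (by positivity), Real.norm_of_nonneg
        (add_nonneg (by positivity) (mul_nonneg (mul_nonneg (by positivity) (by linarith)) hq0))]
        at hc
      rw [hμ, le_div_iff₀ (by linarith)]
      linarith
    have hsq : Real.sqrt ((p n : ℝ) * L / ((N n : ℝ) * (M n : ℝ))) ≤ q n := by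
      rwa [one_mul, Real.norm_of_nonneg (Real.sqrt_nonneg _), Real.norm_of_nonneg hq0] at hs
    have hμ0 : 0 < μ := lt_of_lt_of_le (by positivity) hμL
    set m : ℝ := if M n = 1 then (N n : ℝ) * p n / 2 else N n * q n / 4 with hm
    have hμm : μ * L ≤ 32 * m ^ 2 := by
      rw [hm]
      -- For one block m = μ/2, and L ≤ L⁴ ≤ μ suffices; for several, 32m² = 2(Nq)².
      split_ifs with h
      · have hμ' : μ = N n * p n := by rw [hμ, h]; simp
        have hLμ : L ≤ L ^ 4 := le_self_pow₀ (by linarith) (by norm_num)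
        rw [← hμ']
        nlinarith
      · have := SBM.expectedDegree_mul_log_le hM1' (by linarith) hq0 (by linarith) hμ hμL hsq
        linarith
    have hm0 : 0 ≤ m := by
      rw [hm]; split_ifs <;> positivity
    have hmpos : 0 < m := by
      refine lt_of_le_of_ne hm0 fun h0 => ?_
      rw [← h0] at hμm
      have : 0 < μ * L := mul_pos hμ0 (by linarith)
      linarith
    have hμm' : 1728 * μ ≤ ε' ^ 2 * m ^ 2 := by
      have h1 := mul_le_mul_of_nonneg_left hμm (sq_nonneg ε')
      have h2 := mul_le_mul_of_nonneg_right hLε hμ0.le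
      linarith
    have hfail := (SBM.measure_not_regular_expands_le (B n) (p n) (q n) (η := ε' / 16)
      (by positivity) (by linarith) (SBM.sum_edgeProb (hB n) (p n) (q n))
      fun S hS => SBM.mul_card_le_sum_edgeProb (hB n) (p n) (q n) hS).trans
      (SBM.failure_bound_le hn1 hLdef hε0 hε1 hLε hm0 hμL hμm)
    have hcompl : (SBM.sbmMeasure (B n) (p n) (q n)).real (A n)ᶜ ≤ 4 / N n := by
      refine le_trans (measureReal_mono ?_) hfail
      intro ω hω hgood
      refine hω ?_
      obtain ⟨hcon, hhit⟩ := SBM.connected_and_avgHit hμ0 hmpos hε0 hε1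
        (by rw [div_le_iff₀ hε0] at hn4; linarith) hμm' hgood.1 hgood.2
      exact ⟨hcon, fun w => ⟨(hhit w).1, (hhit w).2.trans (min_le_left _ _)⟩⟩
    rw [probReal_compl_eq_one_sub (Set.toFinite _).measurableSet] at hcompl
    linarith
  have hlim : Tendsto (fun n => (SBM.sbmMeasure (B n) (p n) (q n)).real (A n)) atTop (𝓝 1) := by
    have h1 : Tendsto (fun n => 1 - 4 / (N n : ℝ)) atTop (𝓝 1) := by
      simpa using (hNR.const_div_atTop 4).const_sub 1
    exact tendsto_of_tendsto_of_tendsto_of_le_of_le' h1 tendsto_const_nhds hbound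
      (Eventually.of_forall fun n => measureReal_le_one)
  have h := ENNReal.tendsto_ofReal hlim
  rw [ENNReal.ofReal_one] at h
  exact h.congr fun n => ofReal_measureReal
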